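/- Let $S$ be a (Hausdorff) semitopological semigroup, i.e. a semigroup with a Hausdorff topology for which all left translations $t\mapsto st$ and all right translations $t\mapsto ts$ are continuous. Let $C(S)$ be the $C^*$-algebra of bounded continuous functions $S\to\mathbb{C}$, and for $f\in C(S)$, $s\in S$ put $(L_sf)(t)=f(st)$ and $(R_sf)(t)=f(ts)$. Let $\mathcal F$ be an $m$-admissible subalgebra of $C(S)$: a $C^*$-subalgebra (norm closed) containing the constant functions, with $L_sf,R_sf\in\mathcal F$ for all $f\in\mathcal F$, $s\in S$, and such that for every $f\in\mathcal F$ and every $\mu$ in the spectrum $\Delta$ of $\mathcal F$ (the non-zero multiplicative continuous linear functionals on $\mathcal F$) the function $T_\mu f\colon s\mapsto \mu(L_sf)$ belongs to $\mathcal F$. Then $\Delta$ is a semigroup under $(\mu\nu)(f)=\mu(T_\nu f)$. An $\mathcal F$-filter on $S$ is a (proper) filter $\varphi$ on $S$ such that for every $A\in\varphi$ with $A\neq S$ there are $B\in\varphi$ and $f\in\mathcal F$ with $f=0$ on $B$ and $f=1$ on $S\setminus A$; an $\mathcal F$-ultrafilter is an $\mathcal F$-filter that is maximal with respect to inclusion.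 Let $\delta S$ be the set of all $\mathcal F$-ultrafilters on $S$, with the topology having the sets $\widehat A=\{p\in\delta S: A\in p\}$, $A\subseteq S$, as a base. For $\mu\in\Delta$ the sets $\{s\in S:|f(s)|\le r\}$ with $f\in\ker\mu$, $r>0$ generate an $\mathcal F$-ultrafilter $p(\mu)$, the map $\mu\mapsto p(\mu)$ is a bijection from $\Delta$ onto $\delta S$, and $\delta S$ is given the semigroup operation $p(\mu)p(\nu)=p(\mu\nu)$. Let $K$ be the smallest (two-sided) ideal of $\delta S$, and $\overline K$ its closure in $\delta S$. For $s\in S$ and $B\subseteq S$ write $s^{-1}B=\{x\in S: sx\in B\}$. A set $A\subseteq S$ is piecewise syndetic if there is a finite set $E\subseteq S$ such that the family $\{s^{-1}(\bigcup_{t\in E}t^{-1}A): s\in S\}$ has the finite intersection property. Then, for every $p\in\delta S$, one has $p\in\overline K$ if and only if every $A\in p$ is piecewise syndetic. -/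

import Mathlib

open Set Filter Topology WeakDual
open scoped BoundedContinuousFunction

namespace SemigroupCompactification

section Translations

variable {S : Type*} [Semigroup S] [TopologicalSpace S] [SeparatelyContinuousMul S]

/-- The left translate `L_s f = f ∘ λ_s`, that is, `(L_s f)(t) = f (s t)`. -/
noncomputable def leftTranslate (s : S) (f : S →ᵇ ℂ) : S →ᵇ ℂ :=
  f.compContinuous ⟨fun t => s * t, SeparatelyContinuousMul.continuous_const_mul⟩

/-- The right translate `R_s f = f ∘ ρ_s`, that is, `(R_s f)(t) = f (t s)`. -/
noncomputable def rightTranslate (s : S) (f : S →ᵇ ℂ) : S →ᵇ ℂ :=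
  f.compContinuous ⟨fun t => t * s, SeparatelyContinuousMul.continuous_mul_const⟩

/-- A unital star subalgebra `F` of `C(S)` is an m-admissible subalgebra if it is norm closed
(so a C⋆-subalgebra containing the constants), left and right translation invariant, and if the
function `T_μ f : s ↦ μ (L_s f)` belongs to `F` for every `f ∈ F` and every `μ` in the spectrum
of `F`. -/
class IsMAdmissible (F : StarSubalgebra ℂ (S →ᵇ ℂ)) : Prop where
  isClosed : IsClosed (F : Set (S →ᵇ ℂ))
  left_mem : ∀ s : S, ∀ f ∈ F, leftTranslate s f ∈ F
  right_mem : ∀ s : S, ∀ f ∈ F, rightTranslate s f ∈ F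
  introverted : ∀ μ : characterSpace ℂ F, ∀ f : F,
    ∃ g ∈ F, ∀ s : S, g s = μ ⟨leftTranslate s f, left_mem s f f.2⟩

end Translations

section FFilters

variable {S : Type*} [TopologicalSpace S]

/-- An `F`-filter on `S`: a (proper) filter `φ` such that for every `A ∈ φ` with `A ≠ S` there
are `B ∈ φ` and `f ∈ F` with `f = 0` on `B` and `f = 1` on the complement of `A`. -/
def IsFFilter (F : StarSubalgebra ℂ (S →ᵇ ℂ)) (φ : Filter S) : Prop :=
  φ.NeBot ∧ ∀ A ∈ φ, A ≠ univ →
    ∃ B ∈ φ, ∃ f ∈ F, (∀ x ∈ B, f x = 0) ∧ ∀ x ∈ Aᶜ, f x = 1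

/-- An `F`-ultrafilter on `S`: an `F`-filter which is maximal with respect to inclusion among all
`F`-filters. -/
def IsFUltrafilter (F : StarSubalgebra ℂ (S →ᵇ ℂ)) (p : Filter S) : Prop :=
  IsFFilter F p ∧ ∀ φ : Filter S, IsFFilter F φ → p.sets ⊆ φ.sets → φ.sets ⊆ p.sets

/-- The space `δS` of all `F`-ultrafilters on `S`. -/
def DeltaS (F : StarSubalgebra ℂ (S →ᵇ ℂ)) : Type _ := {p : Filter S // IsFUltrafilter F p}

/-- The set `Â = {p ∈ δS : A ∈ p}`. -/
def hat (F : StarSubalgebra ℂ (S →ᵇ ℂ)) (A : Set S) : Set (DeltaS F) := {p | A ∈ p.1}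

/-- The topology of `δS`: the sets `Â`, for `A ⊆ S`, form a base (they are closed under finite
intersections). -/
instance (F : StarSubalgebra ℂ (S →ᵇ ℂ)) : TopologicalSpace (DeltaS F) :=
  TopologicalSpace.generateFrom (range (hat F))

end FFilters

section SpectrumMul

theorem ext_apply {S : Type*} [TopologicalSpace S] (F : StarSubalgebra ℂ (S →ᵇ ℂ)) {f g : F}
    (h : ∀ s, (f : S →ᵇ ℂ) s = (g : S →ᵇ ℂ) s) : f = g :=
  Subtype.ext (BoundedContinuousFunction.ext h)

variable {S : Type*} [Semigroup S] [TopologicalSpace S] [SeparatelyContinuousMul S]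

instance isClosed_coe (F : StarSubalgebra ℂ (S →ᵇ ℂ)) [IsMAdmissible F] :
    IsClosed (F : Set (S →ᵇ ℂ)) := IsMAdmissible.isClosed

variable (F : StarSubalgebra ℂ (S →ᵇ ℂ)) [IsMAdmissible F]

/-- The left translation `L_s` as a map of `F` into itself. -/
noncomputable def leftTr (s : S) (f : F) : F := ⟨leftTranslate s f, IsMAdmissible.left_mem s f f.2⟩

@[simp] theorem leftTr_apply (s t : S) (f : F) :
    (leftTr F s f : S →ᵇ ℂ) t = (f : S →ᵇ ℂ) (s * t) := rfl

/-- The left introversion operator: `(T_μ f)(s) = μ (L_s f)`. -/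
noncomputable def introFun (μ : characterSpace ℂ F) (f : F) : F :=
  ⟨(IsMAdmissible.introverted μ f).choose, (IsMAdmissible.introverted μ f).choose_spec.1⟩

theorem introFun_apply (μ : characterSpace ℂ F) (f : F) (s : S) :
    (introFun F μ f : S →ᵇ ℂ) s = μ (leftTr F s f) :=
  (IsMAdmissible.introverted μ f).choose_spec.2 s

/-- `T_μ`, for `μ` in the spectrum, is an algebra homomorphism. -/
noncomputable def intro (μ : characterSpace ℂ F) : F →ₐ[ℂ] F where
  toFun := introFun F μ
  map_one' := ext_apply F fun s => by
    rw [introFun_apply]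
    exact map_one μ
  map_mul' f g := ext_apply F fun s => by
    change _ = (introFun F μ f : S →ᵇ ℂ) s * (introFun F μ g : S →ᵇ ℂ) s
    simp only [introFun_apply]
    exact map_mul μ (leftTr F s f) (leftTr F s g)
  map_zero' := ext_apply F fun s => by
    rw [introFun_apply]
    exact map_zero μ
  map_add' f g := ext_apply F fun s => by
    change _ = (introFun F μ f : S →ᵇ ℂ) s + (introFun F μ g : S →ᵇ ℂ) s
    simp only [introFun_apply]
    exact map_add μ (leftTr F s f) (leftTr F s g)
  commutes' c := ext_apply F fun s => by
    rw [introFun_apply]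
    exact AlgHomClass.commutes μ c

/-- The product of the spectrum: `(μ ν)(f) = μ (T_ν f)`. -/
noncomputable instance : Mul (characterSpace ℂ F) where
  mul μ ν := CharacterSpace.equivAlgHom.symm
    ((CharacterSpace.equivAlgHom μ).comp (intro F ν))

theorem mul_char_apply (μ ν : characterSpace ℂ F) (f : F) :
    (μ * ν) f = μ (introFun F ν f) := rfl

noncomputable instance : Semigroup (characterSpace ℂ F) where
  mul_assoc μ ν ρ := by
    apply DFunLike.ext
    intro f
    simp only [mul_char_apply]
    congr 1
    apply ext_apply
    intro s
    simp only [introFun_apply, mul_char_apply]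
    congr 1
    apply ext_apply
    intro t
    simp only [introFun_apply, leftTr_apply]
    congr 1
    apply ext_apply
    intro u
    simp [mul_assoc]

end SpectrumMul

section Homeo

variable {S : Type*} [TopologicalSpace S]
variable (F : StarSubalgebra ℂ (S →ᵇ ℂ))

/-- The filter generated by the sets `S(f, r) = {s : |f s| ≤ r}` with `f ∈ ker μ` and `r > 0`. -/
def kerFilter (μ : characterSpace ℂ F) : Filter S where
  sets := {A | ∃ f : F, μ f = 0 ∧ ∃ r : ℝ, 0 < r ∧ {s | ‖(f : S →ᵇ ℂ) s‖ ≤ r} ⊆ A}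
  univ_sets := ⟨0, map_zero μ, 1, one_pos, subset_univ _⟩
  sets_of_superset := by
    rintro A B ⟨f, hf, r, hr, hA⟩ hAB
    exact ⟨f, hf, r, hr, hA.trans hAB⟩
  inter_sets := by
    rintro A B ⟨f, hf, r, hr, hA⟩ ⟨g, hg, r', hr', hB⟩
    refine ⟨star f * f + star g * g, by simp [hf, hg], min (r ^ 2) (r' ^ 2), by positivity, ?_⟩
    intro s hs
    have key : ((star f * f + star g * g : F) : S →ᵇ ℂ) s
        = ((‖(f : S →ᵇ ℂ) s‖ ^ 2 + ‖(g : S →ᵇ ℂ) s‖ ^ 2 : ℝ) : ℂ) := by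
      change star ((f : S →ᵇ ℂ) s) * (f : S →ᵇ ℂ) s + star ((g : S →ᵇ ℂ) s) * (g : S →ᵇ ℂ) s = _
      push_cast
      rw [← Complex.conj_mul', ← Complex.conj_mul']
      rfl
    rw [mem_ofPred_eq, key, Complex.norm_real, Real.norm_of_nonneg (by positivity)] at hs
    have h1 := hs.trans (min_le_left _ _)
    have h2 := hs.trans (min_le_right _ _)
    constructor
    · apply hA
      exact abs_le_of_sq_le_sq' (by nlinarith [sq_nonneg ‖(g : S →ᵇ ℂ) s‖]) hr.le |>.2
    · apply hB
      exact abs_le_of_sq_le_sq' (by nlinarith [sq_nonneg ‖(f : S →ᵇ ℂ) s‖]) hr'.le |>.2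

theorem mem_kerFilter {μ : characterSpace ℂ F} {A : Set S} : A ∈ kerFilter F μ ↔
    ∃ f : F, μ f = 0 ∧ ∃ r : ℝ, 0 < r ∧ {s | ‖(f : S →ᵇ ℂ) s‖ ≤ r} ⊆ A := Iff.rfl

theorem exists_norm_le [IsClosed (F : Set (S →ᵇ ℂ))] {μ : characterSpace ℂ F} {f : F}
    (hf : μ f = 0) {r : ℝ} (hr : 0 < r) : ∃ s, ‖(f : S →ᵇ ℂ) s‖ ≤ r := by
  by_contra! h
  have h0 : ∀ s, (f : S →ᵇ ℂ) s ≠ 0 := fun s hs => by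
    have := h s
    rw [hs, norm_zero] at this
    linarith
  let g : S →ᵇ ℂ := BoundedContinuousFunction.ofNormedAddCommGroup
    (fun s => ((f : S →ᵇ ℂ) s)⁻¹) ((f : S →ᵇ ℂ).continuous.inv₀ h0) r⁻¹ (fun s => by
      rw [norm_inv]
      exact inv_anti₀ hr (h s).le)
  have hfg : (f : S →ᵇ ℂ) * g = 1 := by
    ext s
    exact mul_inv_cancel₀ (h0 s)
  have hu : IsUnit (f : S →ᵇ ℂ) := IsUnit.of_mul_eq_one _ hfg
  have hu' : IsUnit f := (StarSubalgebra.coe_isUnit F).1 hu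
  have := hu'.map (CharacterSpace.toAlgHom μ)
  exact this.ne_zero hf

theorem kerFilter_neBot [IsClosed (F : Set (S →ᵇ ℂ))] (μ : characterSpace ℂ F) :
    (kerFilter F μ).NeBot := by
  refine ⟨fun h => ?_⟩
  have : (∅ : Set S) ∈ kerFilter F μ := by rw [h]; exact mem_bot
  obtain ⟨f, hf, r, hr, hA⟩ := this
  obtain ⟨s, hs⟩ := exists_norm_le F hf hr
  exact hA hs

/-- Evaluation at a point of `S`. -/
noncomputable def evalHom (s : S) : (S →ᵇ ℂ) →⋆ₐ[ℂ] ℂ where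
  toFun f := f s
  map_one' := rfl
  map_mul' _ _ := rfl
  map_zero' := rfl
  map_add' _ _ := rfl
  commutes' _ := rfl
  map_star' _ := rfl

theorem exists_bump [IsClosed (F : Set (S →ᵇ ℂ))] (f : F) {r : ℝ} (hr : 0 < r) :
    ∃ h ∈ F, (∀ s, ‖(f : S →ᵇ ℂ) s‖ ≤ r / 2 → h s = 0) ∧
      ∀ s, r < ‖(f : S →ᵇ ℂ) s‖ → h s = 1 := by
  let θ : ℝ → ℝ := fun x => min 1 (max 0 ((x - r ^ 2 / 4) / (r ^ 2 - r ^ 2 / 4)))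
  have hθ : Continuous θ := by fun_prop
  let a : S →ᵇ ℂ := star (f : S →ᵇ ℂ) * f
  have ha : IsStarNormal a := ⟨Commute.all _ _⟩
  have haF : a ∈ F := mul_mem (star_mem f.2) f.2
  let θc : ℂ → ℂ := fun z => (θ z.re : ℂ)
  have hθc : Continuous θc := by fun_prop
  have hev : ∀ s, cfc θc a s = (θ (‖(f : S →ᵇ ℂ) s‖ ^ 2) : ℂ) := by
    intro s
    have hc : Continuous (evalHom s) := continuous_eval_const (F := S →ᵇ ℂ) s
    have has : evalHom s a = algebraMap ℂ ℂ ((‖(f : S →ᵇ ℂ) s‖ ^ 2 : ℝ) : ℂ) := by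
      change star ((f : S →ᵇ ℂ) s) * (f : S →ᵇ ℂ) s = _
      push_cast
      exact Complex.conj_mul' _
    have h1 : evalHom s (cfc θc a) = cfc θc (evalHom s a) :=
      StarAlgHom.map_cfc (evalHom s) θc a hθc.continuousOn hc ha ⟨Commute.all _ _⟩
    rw [has, cfc_algebraMap] at h1
    exact h1
  have hd : 0 < r ^ 2 - r ^ 2 / 4 := by nlinarith
  refine ⟨cfc θc a, cfc_mem θc haF, fun s hs => ?_, fun s hs => ?_⟩
  · rw [hev]
    have : ‖(f : S →ᵇ ℂ) s‖ ^ 2 - r ^ 2 / 4 ≤ 0 := by nlinarith [norm_nonneg ((f : S →ᵇ ℂ) s)]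
    have h2 : θ (‖(f : S →ᵇ ℂ) s‖ ^ 2) = 0 := by
      simp only [θ]
      rw [max_eq_left (div_nonpos_of_nonpos_of_nonneg this hd.le)]
      simp
    rw [h2, Complex.ofReal_zero]
  · rw [hev]
    have : 1 ≤ (‖(f : S →ᵇ ℂ) s‖ ^ 2 - r ^ 2 / 4) / (r ^ 2 - r ^ 2 / 4) := by
      rw [le_div_iff₀ hd]
      nlinarith [norm_nonneg ((f : S →ᵇ ℂ) s)]
    have h2 : θ (‖(f : S →ᵇ ℂ) s‖ ^ 2) = 1 := by
      simp only [θ]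
      exact min_eq_left (this.trans (le_max_right _ _))
    rw [h2, Complex.ofReal_one]

theorem isFFilter_kerFilter [IsClosed (F : Set (S →ᵇ ℂ))] (μ : characterSpace ℂ F) :
    IsFFilter F (kerFilter F μ) := by
  refine ⟨kerFilter_neBot F μ, ?_⟩
  rintro A ⟨f, hf, r, hr, hA⟩ -
  obtain ⟨h, hF, h0, h1⟩ := exists_bump F f hr
  refine ⟨{s | ‖(f : S →ᵇ ℂ) s‖ ≤ r / 2}, ⟨f, hf, r / 2, half_pos hr, Subset.rfl⟩, h, hF,
    fun x hx => h0 x hx, fun x hx => h1 x ?_⟩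
  by_contra hle
  exact hx (hA (not_lt.1 hle))

theorem near_mem_kerFilter (μ : characterSpace ℂ F) (f : F) {r : ℝ} (hr : 0 < r) :
    {s | ‖(f : S →ᵇ ℂ) s - μ f‖ ≤ r} ∈ kerFilter F μ := by
  refine ⟨f - algebraMap ℂ F (μ f), ?_, r, hr, Subset.rfl⟩
  rw [map_sub, AlgHomClass.commutes μ]
  exact sub_self _

theorem isFUltrafilter_kerFilter [IsClosed (F : Set (S →ᵇ ℂ))] (μ : characterSpace ℂ F) :
    IsFUltrafilter F (kerFilter F μ) := by
  refine ⟨isFFilter_kerFilter F μ, ?_⟩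
  intro φ hφ hsub A hA
  by_cases hAu : A = univ
  · rw [hAu]; exact univ_mem
  obtain ⟨B, hB, f, hfF, h0, h1⟩ := hφ.2 A hA hAu
  have hμ : μ ⟨f, hfF⟩ = 0 := by
    rw [← norm_le_zero_iff]
    refine le_of_forall_pos_le_add fun r hr => ?_
    have hn : {s | ‖f s - μ ⟨f, hfF⟩‖ ≤ r} ∈ φ := hsub (near_mem_kerFilter F μ ⟨f, hfF⟩ hr)
    have := hφ.1
    obtain ⟨s, hs, hsB⟩ := Filter.nonempty_of_mem (inter_mem hn hB)
    rw [mem_ofPred_eq, h0 s hsB, zero_sub, norm_neg] at hs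
    simpa using hs
  refine ⟨⟨f, hfF⟩, hμ, 1 / 2, by norm_num, fun s hs => ?_⟩
  by_contra hsA
  rw [mem_ofPred_eq] at hs
  change ‖f s‖ ≤ 1 / 2 at hs
  rw [h1 s hsA, norm_one] at hs
  norm_num at hs

/-- The map `μ ↦ p(μ)` from the spectrum of `F` to `δS`, where `p(μ)` is the `F`-ultrafilter
generated by the sets `S(f, r)` with `f ∈ ker μ` and `r > 0`. -/
def toDelta [IsClosed (F : Set (S →ᵇ ℂ))] (μ : characterSpace ℂ F) : DeltaS F :=
  ⟨kerFilter F μ, isFUltrafilter_kerFilter F μ⟩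

theorem toDelta_injective [IsClosed (F : Set (S →ᵇ ℂ))] : Function.Injective (toDelta F) := by
  intro μ ν h
  have h' : kerFilter F μ = kerFilter F ν := congrArg Subtype.val h
  apply DFunLike.ext
  intro f
  rw [← sub_eq_zero, ← norm_le_zero_iff]
  refine le_of_forall_pos_le_add fun r hr => ?_
  have h1 := near_mem_kerFilter F μ f (half_pos hr)
  have h2 := near_mem_kerFilter F ν f (half_pos hr)
  rw [← h'] at h2
  have := kerFilter_neBot F μ
  obtain ⟨s, hs1, hs2⟩ := Filter.nonempty_of_mem (inter_mem h1 h2)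
  rw [mem_ofPred_eq] at hs1 hs2
  have h3 : μ f - ν f = ((f : S →ᵇ ℂ) s - ν f) - ((f : S →ᵇ ℂ) s - μ f) := by ring
  rw [h3]
  refine (norm_sub_le _ _).trans ?_
  linarith

theorem exists_limit (u : Ultrafilter S) (f : S →ᵇ ℂ) : ∃ z, Tendsto f u (𝓝 z) := by
  have hK : IsCompact (Metric.closedBall (0 : ℂ) ‖f‖) := isCompact_closedBall 0 ‖f‖
  obtain ⟨z, -, hz⟩ := hK.ultrafilter_le_nhds (u.map f) (by
    rw [le_principal_iff]
    change f ⁻¹' _ ∈ u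
    refine Filter.univ_mem' fun s => ?_
    simpa using f.norm_coe_le_norm s)
  exact ⟨z, hz⟩

theorem exists_limit_char [IsClosed (F : Set (S →ᵇ ℂ))] (u : Ultrafilter S) :
    ∃ μ : characterSpace ℂ F, ∀ f : F, Tendsto (f : S →ᵇ ℂ) u (𝓝 (μ f)) := by
  choose l hl using fun f : F => exists_limit u (f : S →ᵇ ℂ)
  let φ : F →ₐ[ℂ] ℂ :=
    { toFun := l
      map_one' := tendsto_nhds_unique (hl 1) tendsto_const_nhds
      map_mul' := fun f g => tendsto_nhds_unique (hl (f * g)) ((hl f).mul (hl g))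
      map_zero' := tendsto_nhds_unique (hl 0) tendsto_const_nhds
      map_add' := fun f g => tendsto_nhds_unique (hl (f + g)) ((hl f).add (hl g))
      commutes' := fun c => tendsto_nhds_unique (hl (algebraMap ℂ F c)) tendsto_const_nhds }
  exact ⟨CharacterSpace.equivAlgHom.symm φ, hl⟩

theorem toDelta_surjective [IsClosed (F : Set (S →ᵇ ℂ))] : Function.Surjective (toDelta F) := by
  rintro ⟨p, hp⟩
  have := hp.1.1
  obtain ⟨μ, hμ⟩ := exists_limit_char F (Ultrafilter.of p)
  refine ⟨μ, Subtype.ext ?_⟩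
  have hsub : p.sets ⊆ (kerFilter F μ).sets := by
    intro A hA
    by_cases hAu : A = univ
    · rw [hAu]; exact univ_mem
    obtain ⟨B, hB, f, hfF, h0, h1⟩ := hp.1.2 A hA hAu
    have h00 : Tendsto f (Ultrafilter.of p : Filter S) (𝓝 0) :=
      tendsto_const_nhds.congr' (by
        filter_upwards [Ultrafilter.of_le p hB] with x hx
        exact (h0 x hx).symm)
    refine ⟨⟨f, hfF⟩, tendsto_nhds_unique (hμ ⟨f, hfF⟩) h00, 1 / 2, by norm_num, fun s hs => ?_⟩
    by_contra hsA
    rw [mem_ofPred_eq] at hs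
    change ‖f s‖ ≤ 1 / 2 at hs
    rw [h1 s hsA, norm_one] at hs
    norm_num at hs
  exact Filter.filter_eq
    (Subset.antisymm (hp.2 _ (isFFilter_kerFilter F μ) hsub) hsub)

/-- The bijection `μ ↦ p(μ)` between the spectrum of `F` and `δS`. -/
noncomputable def deltaEquiv [IsClosed (F : Set (S →ᵇ ℂ))] : characterSpace ℂ F ≃ DeltaS F :=
  Equiv.ofBijective (toDelta F) ⟨toDelta_injective F, toDelta_surjective F⟩

end Homeo

section DeltaSemigroup

variable {S : Type*} [Semigroup S] [TopologicalSpace S] [SeparatelyContinuousMul S]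

/-- The semigroup operation of `δS`, carried over from the spectrum of `F` along `μ ↦ p(μ)`:
`p(μ) p(ν) = p(μ ν)`. -/
noncomputable instance (F : StarSubalgebra ℂ (S →ᵇ ℂ)) [IsMAdmissible F] :
    Semigroup (DeltaS F) :=
  (deltaEquiv F).symm.semigroup

end DeltaSemigroup

section Ideals

/-- A (two-sided) ideal of a semigroup `T`: a non-empty set `I` with `T I ⊆ I` and `I T ⊆ I`. -/
def IsTwoSidedIdeal {T : Type*} [Semigroup T] (I : Set T) : Prop :=
  I.Nonempty ∧ ∀ x ∈ I, ∀ y : T, y * x ∈ I ∧ x * y ∈ I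

/-- The smallest ideal of a semigroup `T` (when it exists, as it does in every compact right
topological semigroup): the intersection of all ideals of `T`. -/
def smallestIdeal (T : Type*) [Semigroup T] : Set T := ⋂₀ {I | IsTwoSidedIdeal I}

/-- A subset `A` of `S` is piecewise syndetic if there is a finite `E ⊆ S` such that the family of
the sets `s⁻¹ (⋃ t ∈ E, t⁻¹ A)`, for `s ∈ S`, has the finite intersection property, where
`s⁻¹ B = {x : s x ∈ B}`. -/
def IsPiecewiseSyndetic {S : Type*} [Semigroup S] (A : Set S) : Prop :=
  ∃ E : Finset S, ∀ G : Finset S,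
    (⋂ s ∈ G, (fun x => s * x) ⁻¹' (⋃ t ∈ E, (fun x => t * x) ⁻¹' A)).Nonempty

end Ideals

end SemigroupCompactification

/-! The spectrum is a compact right topological semigroup, so its smallest ideal is the union of its
minimal left ideals, described algebraically by `recurrentSet`. As the sets `hat F A` form a base,
`p` lies in the closure of this ideal iff each `A ∈ p` belongs to some `p(ν)` with `ν` recurrent. If
`A ∈ p(ν)` with `ν` recurrent, compactness turns the recurrence of `ν` into a finite `E`
(`isPiecewiseSyndetic_of_mem_kerFilter`). Conversely, for `A ∈ p` pick `B ∈ p` and `f ∈ F` with `f =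
0` on `B`, `f = 1` off `A`. Piecewise syndeticity of `B` yields a recurrent `ν` with `ν f = 0`
(`exists_mem_recurrentSet_of_isPiecewiseSyndetic`), and then `A ∈ p(ν)`. -/

namespace SemigroupCompactification

/-! ### Minimal left ideals and the smallest ideal -/

section Recurrent

/-- The elements `x` of a semigroup that can be recovered from each of their left multiples,
that is, those for which `T x` is a minimal left ideal containing `x`. -/
def recurrentSet (T : Type*) [Semigroup T] : Set T := {x | ∀ y : T, ∃ z : T, z * (y * x) = x}

variable {T : Type*} [Semigroup T]

theorem recurrentSet_mul_left {x : T} (hx : x ∈ recurrentSet T) (y : T) :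
    y * x ∈ recurrentSet T := fun w => by
  obtain ⟨z, hz⟩ := hx (w * y)
  exact ⟨y * z, by rw [mul_assoc, ← mul_assoc w, hz]⟩

theorem recurrentSet_mul_right {x : T} (hx : x ∈ recurrentSet T) (y : T) :
    x * y ∈ recurrentSet T := fun w => by
  obtain ⟨z, hz⟩ := hx w
  exact ⟨z, by rw [← mul_assoc w, ← mul_assoc z, hz]⟩

/-- Recurrent elements form an ideal, and any ideal containing `i` contains `i * x`, hence `z * (i *
x) = x`. -/
theorem smallestIdeal_eq_recurrentSet (h : (recurrentSet T).Nonempty) :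
    smallestIdeal T = recurrentSet T := by
  apply Subset.antisymm
  · exact sInter_subset_of_mem
      ⟨h, fun x hx y => ⟨recurrentSet_mul_left hx y, recurrentSet_mul_right hx y⟩⟩
  · rintro x hx I ⟨⟨i, hi⟩, hI⟩
    obtain ⟨z, hz⟩ := hx i
    rw [← hz]
    exact (hI _ (hI i hi x).2 z).1

theorem map_mem_recurrentSet {T' : Type*} [Semigroup T'] (e : T ≃* T') {x : T} :
    e x ∈ recurrentSet T' ↔ x ∈ recurrentSet T := by
  constructor
  · intro h y
    obtain ⟨z, hz⟩ := h (e y)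
    exact ⟨e.symm z, e.injective (by simpa using hz)⟩
  · intro h y
    obtain ⟨z, hz⟩ := h (e.symm y)
    exact ⟨e z, by simpa using congrArg e hz⟩

/-- In a compact right topological semigroup every principal left ideal `T x` contains a
recurrent element. -/
theorem exists_mul_mem_recurrentSet [TopologicalSpace T] [CompactSpace T] [T2Space T]
    (hc : ∀ y : T, Continuous fun z : T => z * y) (x : T) : ∃ y : T, y * x ∈ recurrentSet T := by
  let 𝓛 : Set (Set T) := {L | IsClosed L ∧ L.Nonempty ∧ ∀ y ∈ L, ∀ z : T, z * y ∈ L}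
  have hprin : ∀ y : T, range (fun z => z * y) ∈ 𝓛 := fun y =>
    ⟨(isCompact_range (hc y)).isClosed, ⟨y * y, y, rfl⟩, by
      rintro _ ⟨w, rfl⟩ z
      exact ⟨z * w, mul_assoc z w y⟩⟩
  -- `L` is a minimal closed left ideal inside `T x`; compactness keeps intersections of chains
  -- non-empty.
  obtain ⟨L, hLx, hL⟩ := zorn_superset_nonempty 𝓛 (fun c hc𝓛 hchain hne => by
    refine ⟨⋂₀ c, ⟨isClosed_sInter fun L hL => (hc𝓛 hL).1, ?_, ?_⟩,
      fun L hL => sInter_subset_of_mem hL⟩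
    · have : Nonempty c := hne.to_subtype
      exact IsCompact.nonempty_sInter_of_directed_nonempty_isCompact_isClosed
        (show IsChain (· ⊇ ·) c from hchain.symm).directedOn (fun L hL => (hc𝓛 hL).2.1)
        (fun L hL => (hc𝓛 hL).1.isCompact) (fun L hL => (hc𝓛 hL).1)
    · exact fun y hy z L hL => (hc𝓛 hL).2.2 y (hy L hL) z) _ (hprin x)
  obtain ⟨l, hl⟩ := hL.prop.2.1
  obtain ⟨y, rfl⟩ := hLx hl
  refine ⟨y, fun w => ?_⟩
  -- `T (w y x)` is a closed left ideal inside `L`, so by minimality it contains `y x`.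
  exact hL.le_of_le (hprin (w * (y * x)))
    (by rintro _ ⟨z, rfl⟩; exact hL.prop.2.2 _ (hL.prop.2.2 _ hl w) z) hl

end Recurrent

/-! ### Recurrent characters and piecewise syndetic sets -/

section Spectrum

variable {S : Type*} [Semigroup S] [TopologicalSpace S] [SeparatelyContinuousMul S]
variable (F : StarSubalgebra ℂ (S →ᵇ ℂ)) [IsMAdmissible F]

theorem continuous_char_apply (f : F) : Continuous fun μ : characterSpace ℂ F => μ f :=
  (WeakDual.eval_continuous f).comp continuous_subtype_val

theorem continuous_char_mul_right (ν : characterSpace ℂ F) :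
    Continuous fun μ : characterSpace ℂ F => μ * ν := by
  refine Continuous.subtype_mk (WeakDual.continuous_of_continuous_eval fun f => ?_) _
  exact continuous_char_apply F (introFun F ν f)

/-- The bijection between the spectrum and `δS` as an isomorphism of semigroups. -/
noncomputable def deltaMulEquiv : characterSpace ℂ F ≃* DeltaS F :=
  ((deltaEquiv F).symm.mulEquiv).symm

theorem exists_mul_mem_recurrentSet_char (μ : characterSpace ℂ F) :
    ∃ ν, ν * μ ∈ recurrentSet (characterSpace ℂ F) :=
  exists_mul_mem_recurrentSet (continuous_char_mul_right F) μ

theorem mem_smallestIdeal_deltaS {μ : characterSpace ℂ F} :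
    deltaMulEquiv F μ ∈ smallestIdeal (DeltaS F) ↔ μ ∈ recurrentSet (characterSpace ℂ F) := by
  obtain ⟨ν, hν⟩ := exists_mul_mem_recurrentSet_char F μ
  rw [smallestIdeal_eq_recurrentSet ⟨_, (map_mem_recurrentSet (deltaMulEquiv F)).2 hν⟩,
    map_mem_recurrentSet]

theorem exists_evalChar (s : S) : ∃ μ : characterSpace ℂ F, ∀ f : F, μ f = (f : S →ᵇ ℂ) s :=
  ⟨CharacterSpace.equivAlgHom.symm ((evalHom s).toAlgHom.comp F.subtype.toAlgHom), fun _ => rfl⟩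

theorem isPiecewiseSyndetic_of_mem_kerFilter {ν : characterSpace ℂ F}
    (hν : ν ∈ recurrentSet (characterSpace ℂ F)) {A : Set S} (hA : A ∈ kerFilter F ν) :
    IsPiecewiseSyndetic A := by
  obtain ⟨f, hf, r, hr, hA⟩ := hA
  have hcover : (univ : Set (characterSpace ℂ F)) ⊆
      ⋃ t : S, {σ | ‖σ (introFun F ν (leftTr F t f))‖ < r} := by
    intro σ _
    -- Since `τ σ ν = ν`, the character `τ` kills `T_{σν} f`, which must therefore be small at some
    -- point `t` of `S`.
    obtain ⟨τ, hτ⟩ := hν σ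
    have h0 : τ (introFun F (σ * ν) f) = 0 := by rw [← mul_char_apply, hτ, hf]
    obtain ⟨t, ht⟩ := exists_norm_le F h0 (half_pos hr)
    rw [introFun_apply, mul_char_apply] at ht
    exact mem_iUnion.2 ⟨t, ht.trans_lt (half_lt_self hr)⟩
  obtain ⟨E, hE⟩ := isCompact_univ.elim_finite_subcover _ (fun t =>
    isOpen_lt (continuous_char_apply F _).norm continuous_const) hcover
  refine ⟨E, fun G => ?_⟩
  have hs : ∀ s : S, ∃ t ∈ E, ‖ν (leftTr F s (leftTr F t f))‖ < r := by
    intro s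
    -- Applying the finite cover to evaluation at `s` makes `E` work uniformly in `s`.
    obtain ⟨ε, hε⟩ := exists_evalChar F s
    obtain ⟨t, htE, ht⟩ := mem_iUnion₂.1 (hE (mem_univ ε))
    rw [mem_ofPred_eq, hε, introFun_apply] at ht
    exact ⟨t, htE, ht⟩
  have := kerFilter_neBot F ν
  -- All the sets of the family lie in the single proper filter `p(ν)`.
  refine Filter.nonempty_of_mem (f := kerFilter F ν) ((Filter.biInter_finset_mem G).2 fun s _ => ?_)
  obtain ⟨t, htE, ht⟩ := hs s
  filter_upwards [near_mem_kerFilter F ν (leftTr F s (leftTr F t f)) (sub_pos.2 ht)] with x hx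
  refine mem_iUnion₂.2 ⟨t, htE, hA ?_⟩
  rw [leftTr_apply, leftTr_apply] at hx
  have := norm_le_norm_add_norm_sub' ((f : S →ᵇ ℂ) (t * (s * x)))
    (ν (leftTr F s (leftTr F t f)))
  change ‖(f : S →ᵇ ℂ) (t * (s * x))‖ ≤ r
  linarith

theorem exists_mem_recurrentSet_of_isPiecewiseSyndetic {B : Set S} (hB : IsPiecewiseSyndetic B)
    {f : F} (hf : ∀ x ∈ B, (f : S →ᵇ ℂ) x = 0) :
    ∃ ν ∈ recurrentSet (characterSpace ℂ F), ν f = 0 := by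
  obtain ⟨E, hE⟩ := hB
  let φ : Filter S := ⨅ s : S, 𝓟 ((fun x => s * x) ⁻¹' (⋃ t ∈ E, (fun x => t * x) ⁻¹' B))
  have hφ : φ.NeBot := by
    refine (Filter.hasBasis_iInf_principal_finite _).neBot_iff.2 fun {G} hG => ?_
    simpa using hE hG.toFinset
  obtain ⟨μ, hμ⟩ := exists_limit_char F (Ultrafilter.of φ)
  -- The product over `E` vanishes on `⋃ t ∈ E, t⁻¹ B`, because one factor does at each point.
  have hzero : ∀ s : S, μ (leftTr F s (∏ t ∈ E, leftTr F t f)) = 0 := by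
    intro s
    refine tendsto_nhds_unique (hμ _) (tendsto_const_nhds.congr' ?_)
    filter_upwards [Ultrafilter.of_le φ (Filter.mem_iInf_of_mem s (mem_principal_self _))]
      with x hx
    obtain ⟨t, htE, ht⟩ := mem_iUnion₂.1 hx
    obtain ⟨ε, hε⟩ := exists_evalChar F (s * x)
    rw [leftTr_apply, ← hε, map_prod]
    refine (Finset.prod_eq_zero htE ?_).symm
    rw [hε, leftTr_apply]
    exact hf _ ht
  have hintro : introFun F μ (∏ t ∈ E, leftTr F t f) = 0 :=
    ext_apply F fun s => by rw [introFun_apply, hzero]; rfl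
  obtain ⟨σ, hσ⟩ := exists_mul_mem_recurrentSet_char F μ
  have hprod : ∏ t ∈ E, (σ * μ) (leftTr F t f) = 0 := by
    rw [← map_prod, mul_char_apply, hintro, map_zero]
  -- Multiplicativity singles out one `t`; multiplying by evaluation at `t` on the left then absorbs
  -- the translation `L_t`.
  obtain ⟨t, -, ht⟩ := Finset.prod_eq_zero_iff.1 hprod
  obtain ⟨ε, hε⟩ := exists_evalChar F t
  refine ⟨ε * (σ * μ), recurrentSet_mul_left hσ ε, ?_⟩
  rw [mul_char_apply, hε, introFun_apply, ht]

end Spectrum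

/-! ### Closure in `δS` and the conclusion -/

theorem mem_closure_deltaS_iff {S : Type*} [TopologicalSpace S] {F : StarSubalgebra ℂ (S →ᵇ ℂ)}
    {p : DeltaS F} {K : Set (DeltaS F)} :
    p ∈ closure K ↔ ∀ A ∈ p.1, ∃ q ∈ K, A ∈ q.1 := by
  have hb : TopologicalSpace.IsTopologicalBasis (range (hat F)) :=
    { exists_subset_inter := by
        rintro _ ⟨A, rfl⟩ _ ⟨B, rfl⟩ q ⟨hA, hB⟩
        exact ⟨_, ⟨A ∩ B, rfl⟩, inter_mem hA hB, fun q hq =>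
          ⟨mem_of_superset hq inter_subset_left, mem_of_superset hq inter_subset_right⟩⟩
      sUnion_eq := eq_univ_of_forall fun q => ⟨_, ⟨univ, rfl⟩, univ_mem⟩
      eq_generateFrom := rfl }
  rw [hb.mem_closure_iff, forall_mem_range]
  exact forall_congr' fun A => imp_congr_right fun _ =>
    ⟨fun ⟨q, hA, hK⟩ => ⟨q, hK, hA⟩, fun ⟨q, hK, hA⟩ => ⟨q, hA, hK⟩⟩

end SemigroupCompactification

open SemigroupCompactification in
theorem mainTheorem3 {S : Type*} [Semigroup S] [TopologicalSpace S] [T2Space S]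
    [SeparatelyContinuousMul S] (F : StarSubalgebra ℂ (BoundedContinuousFunction S ℂ))
    [SemigroupCompactification.IsMAdmissible F] (p : SemigroupCompactification.DeltaS F) :
    p ∈ closure (SemigroupCompactification.smallestIdeal (SemigroupCompactification.DeltaS F)) ↔
      ∀ A ∈ p.1, SemigroupCompactification.IsPiecewiseSyndetic A := by
  rw [mem_closure_deltaS_iff]
  constructor
  · intro h A hA
    obtain ⟨q, hq, hAq⟩ := h A hA
    obtain ⟨ν, rfl⟩ := (deltaMulEquiv F).surjective q
    exact isPiecewiseSyndetic_of_mem_kerFilter F ((mem_smallestIdeal_deltaS F).1 hq) hAq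
  · intro h A hA
    have key : ∃ B ∈ p.1, ∃ f ∈ F, (∀ x ∈ B, f x = 0) ∧ ∀ x ∈ Aᶜ, f x = 1 := by
      by_cases hAu : A = univ
      · exact ⟨univ, univ_mem, 0, zero_mem F, fun _ _ => rfl,
          fun x hx => (hx (hAu ▸ mem_univ x)).elim⟩
      · exact p.2.1.2 A hA hAu
    obtain ⟨B, hB, f, hfF, h0, h1⟩ := key
    obtain ⟨ν, hν, hνf⟩ :=
      exists_mem_recurrentSet_of_isPiecewiseSyndetic F (h B hB) (f := ⟨f, hfF⟩) h0
    -- Any radius below `1` would do: `f = 1` off `A` forces `{|f| ≤ 1/2} ⊆ A`.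
    refine ⟨deltaMulEquiv F ν, (mem_smallestIdeal_deltaS F).2 hν, ⟨f, hfF⟩, hνf, 1 / 2,
      by norm_num, fun s hs => ?_⟩
    by_contra hsA
    have hs' : ‖f s‖ ≤ 1 / 2 := hs
    rw [h1 s hsA, norm_one] at hs'
    norm_num at hs'
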